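/- Let $M$ be a closed smooth manifold with a continuous Riemannian metric, and let $f\colon M\to M$ be a $C^1$ diffeomorphism that is partially hyperbolic: there is a continuous $Df$-invariant splitting $TM=E^s\oplus E^c\oplus E^u$, with $E^s$ or $E^u$ nonzero at every point, such that $E^s$ is uniformly contracted, $E^u$ is uniformly expanded and the splitting is dominated. That is, for suitable $l\in\mathbb N$ one has $\|Df^l v\|\le\frac12\|v\|$ for $v\in E^s$; for suitable $l$, $\|Df^l v\|\ge 2\|v\|$ for $v\in E^u$; and, for each of the pairs $(E_1,E_2)=(E^s,E^c)$ and $(E^c,E^u)$, there is $l$ such that $\|Df^l(x)v\|\le\frac12\|Df^l(x)w\|$ for all $x\in M$ and all unit vectors $v\in E_1(x)$, $w\in E_2(x)$. Assume that the center foliation is a circle fibration: there is a locally trivial fiber bundle $p\colon M\to B$ with fiber the circle, whose fibers are $C^1$ embedded circles tangent to $E^c$ (so $\dim E^c=1$) and are mapped to fibers by $f$. The fibers of $p$ are called the center leaves. Let $\mu$ be an ergodic $f$-invariant Borel probability measure on $M$ whose center Lyapunov exponent is nonzero: there is a real number $\lambda^c\ne0$ such that for $\mu$-almost every $x$ and all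 $0\ne v\in E^c(x)$, $$\lim_{k\to\infty}\frac1k\log\|Df^k(x)v\|=\lambda^c .$$ Then $\mu$ has a system of conditional measures along the center leaves, i.e. a family of Borel measures $(\mu_b)_{b\in B}$ on $M$ such that for $p_*\mu$-almost every $b$ the measure $\mu_b$ is a probability measure with $\mu_b(M\setminus p^{-1}(b))=0$, and such that for every Borel set $A\subseteq M$ the function $b\mapsto\mu_b(A)$ is $p_*\mu$-measurable and $\mu(A)=\int_B\mu_b(A)\,d(p_*\mu)(b)$. Moreover, for every such system and for $p_*\mu$-almost every $b\in B$, the conditional measure $\mu_b$ and the Lebesgue measure (arc length) on the leaf $p^{-1}(b)$ are mutually singular. -/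

import Mathlib

open Set Filter Topology MeasureTheory Manifold Bundle
open scoped ContDiff ENNReal

noncomputable section

namespace CenterFoliation

/-- A family of subspaces `V x ⊆ T_x M` is a continuous subbundle of `TM`: near every point it has
a frame of continuous vector fields. -/
def IsContinuousSubbundle {n : ℕ} {M : Type*} [TopologicalSpace M]
    [ChartedSpace (EuclideanSpace ℝ (Fin n)) M] [IsManifold (𝓡 n) ∞ M]
    (V : ∀ x : M, Submodule ℝ (TangentSpace (𝓡 n) x)) : Prop :=
  ∀ x₀ : M, ∃ U : Set M, IsOpen U ∧ x₀ ∈ U ∧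
    ∃ (d : ℕ) (X : Fin d → ∀ x : M, TangentSpace (𝓡 n) x),
      (∀ i, ContinuousOn (fun x => (⟨x, X i x⟩ : TangentBundle (𝓡 n) M)) U) ∧
      ∀ x ∈ U, LinearIndependent ℝ (fun i => X i x) ∧
        Submodule.span ℝ (range fun i => X i x) = V x

/-- `E₁` is dominated by `E₂` along the orbits of `f`: some iterate `f^l` expands every unit vector
of `E₂ x` at least twice as much as every unit vector of `E₁ x`. -/
def IsDominatedBy {n : ℕ} {M : Type*} [TopologicalSpace M]
    [ChartedSpace (EuclideanSpace ℝ (Fin n)) M]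
    [RiemannianBundle (fun x : M => TangentSpace (𝓡 n) x)]
    (f : M → M) (E₁ E₂ : ∀ x : M, Submodule ℝ (TangentSpace (𝓡 n) x)) : Prop :=
  ∃ l : ℕ, ∀ x : M, ∀ v ∈ E₁ x, ∀ w ∈ E₂ x, ‖v‖ = 1 → ‖w‖ = 1 →
    ‖mfderiv (𝓡 n) (𝓡 n) f^[l] x v‖ ≤ 1 / 2 * ‖mfderiv (𝓡 n) (𝓡 n) f^[l] x w‖

/-- The diffeomorphism `f` is partially hyperbolic with splitting `TM = Es ⊕ Ec ⊕ Eu`: the splitting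
is continuous and `Df`-invariant, `Es` is uniformly contracted, `Eu` is uniformly expanded, and
the splitting is dominated. On a compact manifold this does not depend on the Riemannian metric.
Only one of the bundles `Es`, `Eu` is required to be nontrivial, so this covers both conventions
in use. -/
structure IsPartiallyHyperbolic {n : ℕ} {M : Type*} [TopologicalSpace M]
    [ChartedSpace (EuclideanSpace ℝ (Fin n)) M] [IsManifold (𝓡 n) ∞ M]
    [RiemannianBundle (fun x : M => TangentSpace (𝓡 n) x)]
    (f : M ≃ₘ^1⟮𝓡 n, 𝓡 n⟯ M)
    (Es Ec Eu : ∀ x : M, Submodule ℝ (TangentSpace (𝓡 n) x)) : Prop where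
  continuous_s : IsContinuousSubbundle Es
  continuous_c : IsContinuousSubbundle Ec
  continuous_u : IsContinuousSubbundle Eu
  /-- Every tangent vector is uniquely a sum of vectors of the three subspaces. -/
  isInternal : ∀ x, DirectSum.IsInternal (![Es x, Ec x, Eu x])
  nontrivial : ∀ x, Es x ≠ ⊥ ∨ Eu x ≠ ⊥
  map_s : ∀ x, (Es x).map (mfderiv (𝓡 n) (𝓡 n) f x).toLinearMap = Es (f x)
  map_c : ∀ x, (Ec x).map (mfderiv (𝓡 n) (𝓡 n) f x).toLinearMap = Ec (f x)
  map_u : ∀ x, (Eu x).map (mfderiv (𝓡 n) (𝓡 n) f x).toLinearMap = Eu (f x)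
  contracting : ∃ l : ℕ, ∀ x, ∀ v ∈ Es x, ‖mfderiv (𝓡 n) (𝓡 n) f^[l] x v‖ ≤ 1 / 2 * ‖v‖
  expanding : ∃ l : ℕ, ∀ x, ∀ v ∈ Eu x, 2 * ‖v‖ ≤ ‖mfderiv (𝓡 n) (𝓡 n) f^[l] x v‖
  dominated_sc : IsDominatedBy f Es Ec
  dominated_cu : IsDominatedBy f Ec Eu

/-- `γ` is a `1`-periodic regular `C^1` parametrization of the set `C`, which is traversed exactly
once per period, and `C` is tangent to the line field `Ec` at each of its points. Thus `C` is a
`C^1` embedded circle with tangent line `Ec x` at every `x ∈ C`. -/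
structure IsLeafParametrization {n : ℕ} {M : Type*} [TopologicalSpace M]
    [ChartedSpace (EuclideanSpace ℝ (Fin n)) M]
    (Ec : ∀ x : M, Submodule ℝ (TangentSpace (𝓡 n) x)) (C : Set M) (γ : ℝ → M) : Prop where
  contMDiff : ContMDiff 𝓘(ℝ, ℝ) (𝓡 n) 1 γ
  periodic : Function.Periodic γ 1
  injOn : InjOn γ (Ioc 0 1)
  range_eq : range γ = C
  velocity_ne_zero : ∀ t : ℝ, mfderiv 𝓘(ℝ, ℝ) (𝓡 n) γ t 1 ≠ 0
  tangent : ∀ t : ℝ, Submodule.span ℝ {mfderiv 𝓘(ℝ, ℝ) (𝓡 n) γ t 1} = Ec (γ t)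

/-- The fibers of `p : M → B` are the leaves of an `f`-invariant foliation of `M` which integrates
`Ec` and which is a circle fibration: `p` is a locally trivial bundle with fiber the circle, each
fiber is a `C^1` embedded circle tangent to `Ec`, and `f` maps fibers to fibers. -/
structure IsCenterCircleFibration {n : ℕ} {M : Type*} [TopologicalSpace M]
    [ChartedSpace (EuclideanSpace ℝ (Fin n)) M]
    (f : M → M) (Ec : ∀ x : M, Submodule ℝ (TangentSpace (𝓡 n) x))
    {B : Type*} [TopologicalSpace B] (p : M → B) : Prop where
  locally_trivial : ∀ b : B, ∃ e : Trivialization Circle p, b ∈ e.baseSet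
  leaf : ∀ b : B, ∃ γ : ℝ → M, IsLeafParametrization Ec (p ⁻¹' {b}) γ
  invariant : ∀ x y : M, p x = p y ↔ p (f x) = p (f y)

/-- For `μ`-almost every point `x`, the Lyapunov exponent of `f` at `x` exists in every nonzero
direction of `Ec x` and equals `lam`. -/
def HasCenterExponent {n : ℕ} {M : Type*} [TopologicalSpace M]
    [ChartedSpace (EuclideanSpace ℝ (Fin n)) M] [MeasurableSpace M]
    [RiemannianBundle (fun x : M => TangentSpace (𝓡 n) x)]
    (f : M → M) (Ec : ∀ x : M, Submodule ℝ (TangentSpace (𝓡 n) x))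
    (μ : Measure M) (lam : ℝ) : Prop :=
  ∀ᵐ x ∂μ, ∀ v ∈ Ec x, v ≠ 0 →
    Tendsto (fun k : ℕ => 1 / (k : ℝ) * Real.log ‖mfderiv (𝓡 n) (𝓡 n) f^[k] x v‖) atTop (𝓝 lam)

/-- Lebesgue measure (Riemannian arc length) on the closed leaf with `1`-periodic parametrization
`γ`, seen as a measure on `M`: a set `A` has measure `∫ ‖γ'(t)‖ dt` over `{t ∈ (0, 1] | γ t ∈ A}`. -/
def leafLebesgue (n : ℕ) {M : Type*} [TopologicalSpace M]
    [ChartedSpace (EuclideanSpace ℝ (Fin n)) M] [MeasurableSpace M]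
    [RiemannianBundle (fun x : M => TangentSpace (𝓡 n) x)] (γ : ℝ → M) : Measure M :=
  ((volume.restrict (Ioc (0 : ℝ) 1)).withDensity
    fun t => ‖mfderiv 𝓘(ℝ, ℝ) (𝓡 n) γ t 1‖ₑ).map γ

/-- `κ` is a system of conditional measures (a disintegration) of `μ` along the fibers of `p`. -/
structure IsConditionalSystem {M B : Type*} [MeasurableSpace M] [MeasurableSpace B]
    (p : M → B) (μ : Measure M) (κ : B → Measure M) : Prop where
  isProbabilityMeasure : ∀ᵐ b ∂(μ.map p), IsProbabilityMeasure (κ b)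
  supported : ∀ᵐ b ∂(μ.map p), κ b (p ⁻¹' {b})ᶜ = 0
  aemeasurable : ∀ A : Set M, MeasurableSet A → AEMeasurable (fun b => κ b A) (μ.map p)
  disintegrates : ∀ A : Set M, MeasurableSet A → μ A = ∫⁻ b, κ b A ∂(μ.map p)

end CenterFoliation

end

/-! The mechanism is that leaves have bounded length, while center vectors at typical points are
stretched without bound by suitable iterates of the dynamics.

All leaves have length at most some `C < ∞` (`exists_leaf_length_le`). Near a given point there is a
bounded `C^1` function whose derivative does not vanish on the center line field, so an arc of a
leaf inside a small neighborhood has bounded length (`exists_arc_length_le`). Local triviality of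
the fibration shows that each leaf meets a small flow box in at most one arc
(`exists_nhds_length_le`), and finitely many flow boxes cover the compact manifold.

If `λ > 0`, then for almost every `x` the iterates `Df^k` stretch the center vectors at `x`
indefinitely. If `λ < 0`, the same holds for some subsequence of the iterates of `f⁻¹`: by
invariance of `μ`, the estimate `‖Df^k‖ ≤ exp (λ k / 2)` on the center direction holds at `f^{-k} x`
outside a set whose measure tends to `0`, and the Borel-Cantelli lemma applies along a subsequence
(`HasCenterExponent.exists_ae_tendsto_symm_of_neg`). Thus neither an ergodic theorem nor
distortion estimates are needed.

The image of a leaf under an iterate is a leaf, so its length `∫ ‖Df^k γ'‖` is at most `C`. By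
Fatou's lemma, the points of a leaf whose center vectors are stretched indefinitely form a set of
length zero (`leafLebesgue_eq_zero_of_tendsto_atTop`). This set has full measure for `μ`, hence for
almost every conditional measure, and mutual singularity follows.

Conditional measures exist because `M` is a standard Borel space and `B` is Hausdorff and second
countable; the Hausdorff property is a consequence of local triviality and compactness of the
circle (`t2Space_base`). -/

namespace CenterFoliation

/-! ### Disintegration along the fibers of a bundle with compact fiber -/

section Fibration

variable {M B F : Type*} [TopologicalSpace M] [TopologicalSpace B] [TopologicalSpace F] {p : M → B}

/-- A surjective locally trivial projection is an open quotient map. -/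
theorem isOpenQuotientMap_of_locally_trivial
    (h : ∀ b : B, ∃ e : Trivialization F p, b ∈ e.baseSet) (hs : Function.Surjective p) :
    IsOpenQuotientMap p where
  surjective := hs
  continuous := continuous_iff_continuousAt.2 fun x => by
    obtain ⟨e, he⟩ := h (p x)
    exact e.continuousAt_proj (e.mem_source.2 he)
  isOpenMap := IsOpenMap.of_nhds_le fun x => by
    obtain ⟨e, he⟩ := h (p x)
    exact (e.map_proj_nhds (e.mem_source.2 he)).ge

/-- Fibers of points near `b` stay close to the fiber of `b` if the typical fiber is compact. -/
theorem eventually_preimage_subset [CompactSpace F] (e : Trivialization F p) {b : B}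
    (hb : b ∈ e.baseSet) {O : Set M} (hO : IsOpen O) (hbO : p ⁻¹' {b} ⊆ O) :
    ∀ᶠ b' in 𝓝 b, p ⁻¹' {b'} ⊆ O := by
  have key : ∀ᶠ b' in 𝓝 b, ∀ z ∈ (univ : Set F), e.toOpenPartialHomeomorph.symm (b', z) ∈ O := by
    refine isCompact_univ.eventually_forall_of_forall_eventually fun z _ => ?_
    have hc : ContinuousAt e.toOpenPartialHomeomorph.symm (b, z) :=
      e.toOpenPartialHomeomorph.continuousAt_symm (e.mem_target.2 hb)
    exact hc.eventually (hO.mem_nhds (hbO (e.proj_symm_apply' hb)))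
  filter_upwards [key, e.open_baseSet.mem_nhds hb] with b' h1 h2 x hx
  have hx' : p x = b' := hx
  have hsrc : x ∈ e.source := e.mem_source.2 (hx' ▸ h2)
  have := h1 (e x).2 (mem_univ _)
  rwa [← hx', e.symm_apply_mk_proj hsrc] at this

/-- The base of a locally trivial bundle with compact fiber and Hausdorff total space is
Hausdorff. -/
theorem t2Space_base [T2Space M] [CompactSpace F]
    (h : ∀ b : B, ∃ e : Trivialization F p, b ∈ e.baseSet) (hs : Function.Surjective p) :
    T2Space B := by
  have hq := isOpenQuotientMap_of_locally_trivial h hs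
  rw [t2Space_iff_of_isOpenQuotientMap hq, ← isOpen_compl_iff, isOpen_iff_mem_nhds]
  rintro ⟨x, y⟩ hxy
  obtain ⟨e, he⟩ := h (p x)
  have hK : IsCompact (p ⁻¹' {p x}) := by
    have : p ⁻¹' {p x} = range fun z => e.toOpenPartialHomeomorph.symm (p x, z) := by
      ext w
      constructor
      · intro hw
        have hw' : p w = p x := hw
        exact ⟨(e w).2, by rw [← hw']; exact e.symm_apply_mk_proj (e.mem_source.2 (hw' ▸ he))⟩
      · rintro ⟨z, rfl⟩
        exact e.proj_symm_apply' he
    rw [this]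
    refine isCompact_range (continuous_iff_continuousAt.2 fun z => ?_)
    exact (e.toOpenPartialHomeomorph.continuousAt_symm (e.mem_target.2 he)).comp (by fun_prop)
  have hy : y ∉ p ⁻¹' {p x} := fun hy => hxy (Eq.symm hy)
  obtain ⟨O₁, O₂, h1, h2, hKO, hyO, hd⟩ := hK.separation_of_notMem hy
  have hV := hq.continuous.continuousAt.eventually (eventually_preimage_subset e he h1 hKO)
  rw [nhds_prod_eq]
  filter_upwards [prod_mem_prod hV (h2.mem_nhds hyO)] with q hq' heq
  have h3 : p ⁻¹' {p q.1} ⊆ O₁ := hq'.1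
  exact (disjoint_left.1 hd) (h3 (Eq.symm heq)) hq'.2

/-- A finite measure on a standard Borel space has conditional measures along the fibers of a
measurable map into a Hausdorff second countable space. -/
theorem exists_isConditionalSystem {M B : Type*} [MeasurableSpace M] [StandardBorelSpace M]
    [TopologicalSpace B] [T2Space B] [SecondCountableTopology B] [MeasurableSpace B] [BorelSpace B]
    {p : M → B} (hp : Measurable p) (μ : Measure M) [IsProbabilityMeasure μ] :
    ∃ κ : B → Measure M, IsConditionalSystem p μ κ := by
  have hne : Nonempty M := nonempty_of_isProbabilityMeasure μ
  have hG : Measurable fun x => (p x, x) := hp.prodMk measurable_id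
  let ρ : Measure (B × M) := μ.map fun x => (p x, x)
  have hfst : ρ.fst = μ.map p := Measure.fst_map_prodMk measurable_id
  have hρ : IsFiniteMeasure ρ := Measure.isFiniteMeasure_map μ _
  refine ⟨fun b => ρ.condKernel b, ae_of_all _ fun b => inferInstance, ?_, fun A hA =>
    (ρ.condKernel.measurable_coe hA).aemeasurable, fun A hA => ?_⟩
  · -- the joint law of `(p x, x)` is carried by the graph of `p`
    have hS : MeasurableSet {q : B × M | p q.2 ≠ q.1} :=
      (measurableSet_eq_fun (hp.comp measurable_snd) measurable_fst).compl
    have h0 : ρ {q : B × M | p q.2 ≠ q.1} = 0 := by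
      rw [Measure.map_apply hG hS]; simp
    rw [← Measure.lintegral_condKernel_mem hS, hfst, lintegral_eq_zero_iff] at h0
    · exact h0
    · exact ProbabilityTheory.Kernel.measurable_kernel_prodMk_left hS
  · have h1 := Measure.lintegral_condKernel_mem (ρ := ρ) (measurable_snd hA)
    rw [hfst] at h1
    rw [Measure.map_apply hG (measurable_snd hA)] at h1
    exact h1.symm

end Fibration

/-- A null set of `μ` is null for almost all conditional measures. -/
theorem IsConditionalSystem.ae_eq_zero {M B : Type*} [MeasurableSpace M] [MeasurableSpace B]
    {p : M → B} {μ : Measure M} {κ : B → Measure M} (hκ : IsConditionalSystem p μ κ) {A : Set M}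
    (hA : MeasurableSet A) (h0 : μ A = 0) : ∀ᵐ b ∂(μ.map p), κ b A = 0 := by
  rw [hκ.disintegrates A hA, lintegral_eq_zero_iff' (hκ.aemeasurable A hA)] at h0
  exact h0

/-! ### Norms of tangent vectors and local frames of the center line field -/

section Frame

variable {n : ℕ} {M : Type*} [TopologicalSpace M]
    [ChartedSpace (EuclideanSpace ℝ (Fin n)) M] [IsManifold (𝓡 n) ∞ M]

/-- A continuous line field is locally spanned by one continuous vector field: the number of vector
fields in a local frame is the rank. -/
theorem IsContinuousSubbundle.exists_frame_of_line
    {V : ∀ x : M, Submodule ℝ (TangentSpace (𝓡 n) x)} (hV : IsContinuousSubbundle V)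
    (h1 : ∀ x, ∃ v : TangentSpace (𝓡 n) x, v ≠ 0 ∧ Submodule.span ℝ {v} = V x) (x₀ : M) :
    ∃ U : Set M, IsOpen U ∧ x₀ ∈ U ∧ ∃ Y : ∀ x : M, TangentSpace (𝓡 n) x,
      ContinuousOn (fun x => (⟨x, Y x⟩ : TangentBundle (𝓡 n) M)) U ∧
      ∀ x ∈ U, Y x ≠ 0 ∧ Submodule.span ℝ {Y x} = V x := by
  obtain ⟨U, hU, hx₀, d, X, hX, hspan⟩ := hV x₀
  have hd : d = 1 := by
    obtain ⟨hli, hs⟩ := hspan x₀ hx₀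
    obtain ⟨v, hv0, hv⟩ := h1 x₀
    have e1 := finrank_span_eq_card hli
    have e2 := finrank_span_singleton (K := ℝ) hv0
    rw [hs, ← hv, e2] at e1
    simpa using e1.symm
  subst hd
  refine ⟨U, hU, hx₀, X 0, hX 0, fun x hx => ⟨(hspan x hx).1.ne_zero 0, ?_⟩⟩
  rw [← (hspan x hx).2]
  congr 1
  ext v
  simp [eq_comm]

theorem continuous_velocity {γ : ℝ → M} (hγ : ContMDiff 𝓘(ℝ, ℝ) (𝓡 n) 1 γ) :
    Continuous fun t => (⟨γ t, mfderiv 𝓘(ℝ, ℝ) (𝓡 n) γ t 1⟩ : TangentBundle (𝓡 n) M) := by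
  have h := hγ.continuous_tangentMap le_rfl
  have h2 : Continuous fun t : ℝ => (⟨t, (1 : ℝ)⟩ : TangentBundle 𝓘(ℝ, ℝ) ℝ) :=
    (tangentBundleModelSpaceHomeomorph 𝓘(ℝ, ℝ)).symm.continuous.comp
      (Continuous.prodMk_left (1 : ℝ))
  exact h.comp h2

/-- Along a continuous vector field, the directional derivative of a `C^1` function is
continuous. -/
theorem continuousOn_mfderiv_apply {u : M → ℝ} (hu : ContMDiff (𝓡 n) 𝓘(ℝ, ℝ) 1 u)
    {Y : ∀ x : M, TangentSpace (𝓡 n) x} {s : Set M}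
    (hY : ContinuousOn (fun x => (⟨x, Y x⟩ : TangentBundle (𝓡 n) M)) s) :
    ContinuousOn (fun x => mvfderiv (𝓡 n) u x (Y x)) s := by
  have h1 := (hu.continuous_tangentMap le_rfl).comp_continuousOn hY
  have h2 := (tangentBundleModelSpaceHomeomorph 𝓘(ℝ, ℝ)).continuous.comp_continuousOn h1
  exact continuous_snd.comp_continuousOn h2

variable [RiemannianBundle (fun x : M => TangentSpace (𝓡 n) x)]
    [IsContinuousRiemannianBundle (EuclideanSpace ℝ (Fin n))
      (fun x : M => TangentSpace (𝓡 n) x)]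

theorem continuousOn_norm_tangent {X : Type*} [TopologicalSpace X] {b : X → M}
    {v : ∀ x : X, TangentSpace (𝓡 n) (b x)} {s : Set X}
    (hv : ContinuousOn (fun x => (⟨b x, v x⟩ : TangentBundle (𝓡 n) M)) s) :
    ContinuousOn (fun x => ‖v x‖) s := by
  have h := ContinuousOn.inner_bundle (F := EuclideanSpace ℝ (Fin n)) hv hv
  simp only [real_inner_self_eq_norm_sq] at h
  exact h.sqrt.congr fun x _ => (Real.sqrt_sq (norm_nonneg _)).symm

theorem continuous_speed {γ : ℝ → M} (hγ : ContMDiff 𝓘(ℝ, ℝ) (𝓡 n) 1 γ) :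
    Continuous fun t => ‖mfderiv 𝓘(ℝ, ℝ) (𝓡 n) γ t 1‖ :=
  continuousOn_univ.1 (continuousOn_norm_tangent (continuous_velocity hγ).continuousOn)

theorem continuous_enorm_speed {γ : ℝ → M} (hγ : ContMDiff 𝓘(ℝ, ℝ) (𝓡 n) 1 γ) :
    Continuous fun t => ‖mfderiv 𝓘(ℝ, ℝ) (𝓡 n) γ t 1‖ₑ := by
  simp_rw [← ofReal_norm]
  exact ENNReal.continuous_ofReal.comp (continuous_speed hγ)

end Frame

/-! ### Arcs of leaves inside small open sets have bounded length -/

section Arc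

variable {n : ℕ} {M : Type*} [TopologicalSpace M] [T2Space M] [CompactSpace M]
    [ChartedSpace (EuclideanSpace ℝ (Fin n)) M] [IsManifold (𝓡 n) ∞ M]

/-- A nonzero tangent vector of a compact manifold is detected by a global `C^1` function, namely a
linear functional composed with a Whitney embedding. A global function is bounded by compactness, and
its restriction to a curve is differentiable on the whole parameter line. -/
theorem exists_function_mfderiv_ne_zero {x₀ : M} {v : TangentSpace (𝓡 n) x₀} (hv : v ≠ 0) :
    ∃ u : M → ℝ, ContMDiff (𝓡 n) 𝓘(ℝ, ℝ) 1 u ∧ mvfderiv (𝓡 n) u x₀ v ≠ 0 := by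
  obtain ⟨N, e, he, -, hinj⟩ := exists_embedding_euclidean_of_compact (I := 𝓡 n) (M := M)
  let w : EuclideanSpace ℝ (Fin N) := mfderiv (𝓡 n) (𝓡 N) e x₀ v
  have hw : w ≠ 0 := fun h => hv (hinj x₀ (h.trans (map_zero _).symm))
  have hL : ContMDiff (𝓡 N) 𝓘(ℝ, ℝ) 1 (innerSL ℝ w) :=
    (innerSL ℝ w).contDiff.contMDiff
  have he1 : ContMDiff (𝓡 n) (𝓡 N) 1 e := he.of_le (by simp)
  refine ⟨innerSL ℝ w ∘ e, hL.comp he1, ?_⟩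
  have hcomp := mfderiv_comp x₀ (hL.mdifferentiableAt one_ne_zero)
    (he1.mdifferentiableAt one_ne_zero)
  rw [mfderiv_eq_fderiv, ContinuousLinearMap.fderiv] at hcomp
  have hval : mvfderiv (𝓡 n) (innerSL ℝ w ∘ e) x₀ v = inner ℝ w w :=
    congrArg (fun T => T v) hcomp
  rw [hval]
  simpa using hw

variable [RiemannianBundle (fun x : M => TangentSpace (𝓡 n) x)]
    [IsContinuousRiemannianBundle (EuclideanSpace ℝ (Fin n))
      (fun x : M => TangentSpace (𝓡 n) x)]

/-- Near each point the derivative of some `C^1` function bounds the norm on the line field from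
above. -/
theorem exists_transverse_function {V : ∀ x : M, Submodule ℝ (TangentSpace (𝓡 n) x)}
    (hV : IsContinuousSubbundle V)
    (h1 : ∀ x, ∃ v : TangentSpace (𝓡 n) x, v ≠ 0 ∧ Submodule.span ℝ {v} = V x) (x₀ : M) :
    ∃ W : Set M, IsOpen W ∧ x₀ ∈ W ∧ ∃ u : M → ℝ, ContMDiff (𝓡 n) 𝓘(ℝ, ℝ) 1 u ∧ ∃ C : ℝ, 0 < C ∧
      ∀ x ∈ W, ∀ v ∈ V x, ‖v‖ ≤ C * |mvfderiv (𝓡 n) u x v| := by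
  obtain ⟨U, hU, hxU, Y, hY, hYs⟩ := hV.exists_frame_of_line h1 x₀
  obtain ⟨u, hu, hu0⟩ := exists_function_mfderiv_ne_zero (hYs x₀ hxU).1
  have c1 := (continuousOn_norm_tangent hY).continuousAt (hU.mem_nhds hxU)
  have c2 := (continuousOn_mfderiv_apply hu hY).abs.continuousAt (hU.mem_nhds hxU)
  obtain ⟨C, hC0, hC⟩ : ∃ C : ℝ, 0 < C ∧
      ‖Y x₀‖ < C * |mvfderiv (𝓡 n) u x₀ (Y x₀)| := by
    have hp : 0 < |mvfderiv (𝓡 n) u x₀ (Y x₀)| := abs_pos.2 hu0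
    refine ⟨(‖Y x₀‖ + 1) / |mvfderiv (𝓡 n) u x₀ (Y x₀)|, by positivity, ?_⟩
    rw [div_mul_cancel₀ _ hp.ne']
    linarith
  have ev := (c1.eventually_lt (c2.const_mul C) hC).and (hU.mem_nhds hxU)
  obtain ⟨W, hW, hWo, hxW⟩ := mem_nhds_iff.1 ev
  refine ⟨W, hWo, hxW, u, hu, C, hC0, fun x hx v hv => ?_⟩
  obtain ⟨hlt, hxU'⟩ := hW hx
  rw [← (hYs x hxU').2] at hv
  obtain ⟨a, rfl⟩ := Submodule.mem_span_singleton.1 hv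
  have e1 : mvfderiv (𝓡 n) u x (a • Y x)
      = a * mvfderiv (𝓡 n) u x (Y x) := map_smul _ _ _
  rw [norm_smul, e1, abs_mul, Real.norm_eq_abs]
  nlinarith [abs_nonneg a, hlt]

/-- Arcs of leaves in a small neighborhood have bounded length: a bounded function with nonvanishing
derivative along the line field is strictly monotone on such an arc, and its total variation there
controls the length. -/
theorem exists_arc_length_le {V : ∀ x : M, Submodule ℝ (TangentSpace (𝓡 n) x)}
    (hV : IsContinuousSubbundle V)
    (h1 : ∀ x, ∃ v : TangentSpace (𝓡 n) x, v ≠ 0 ∧ Submodule.span ℝ {v} = V x) (x₀ : M) :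
    ∃ W : Set M, IsOpen W ∧ x₀ ∈ W ∧ ∃ C : ℝ≥0∞, C < ⊤ ∧ ∀ (L : Set M) (γ : ℝ → M),
      IsLeafParametrization V L γ → ∀ a b : ℝ, a ≤ b → (∀ t ∈ Icc a b, γ t ∈ W) →
        ∫⁻ t in Icc a b, ‖mfderiv 𝓘(ℝ, ℝ) (𝓡 n) γ t 1‖ₑ ≤ C := by
  obtain ⟨W, hWo, hxW, u, hu, C, hC, hbound⟩ := exists_transverse_function hV h1 x₀
  obtain ⟨K, hK⟩ := (isCompact_range hu.continuous).isBounded.exists_norm_le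
  refine ⟨W, hWo, hxW, ENNReal.ofReal (C * (2 * K)), ENNReal.ofReal_lt_top, ?_⟩
  intro L γ hγ a b hab hW
  let g : ℝ → ℝ := u ∘ γ
  have hg : ContDiff ℝ 1 g := (hu.comp hγ.contMDiff).contDiff
  have hgd : ∀ t, deriv g t
      = (mfderiv (𝓡 n) 𝓘(ℝ, ℝ) u (γ t) (mfderiv 𝓘(ℝ, ℝ) (𝓡 n) γ t 1) : ℝ) := fun t => by
    have h2 := mfderiv_comp t (hu.mdifferentiableAt one_ne_zero)
      (hγ.contMDiff.mdifferentiableAt one_ne_zero)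
    rw [← fderiv_apply_one_eq_deriv, ← mfderiv_eq_fderiv]
    exact congrArg (fun T => T (1 : ℝ)) h2
  have hsp : ∀ t ∈ Icc a b, ‖mfderiv 𝓘(ℝ, ℝ) (𝓡 n) γ t 1‖ ≤ C * |deriv g t| := fun t ht => by
    rw [hgd]
    refine hbound _ (hW t ht) _ ?_
    rw [← hγ.tangent t]
    exact Submodule.mem_span_singleton_self _
  have hne : ∀ t ∈ Icc a b, deriv g t ≠ 0 := fun t ht h0 => by
    have := hsp t ht
    rw [h0, abs_zero, mul_zero] at this
    exact hγ.velocity_ne_zero t (norm_le_zero_iff.1 this)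
  have hder : ∀ t ∈ Icc a b, HasDerivWithinAt g (deriv g t) (Icc a b) t := fun t _ =>
    (hg.differentiable one_ne_zero).differentiableAt.hasDerivAt.hasDerivWithinAt
  have hint : ∫ t in a..b, deriv g t = g b - g a :=
    intervalIntegral.integral_deriv_eq_sub
      (fun t _ => (hg.differentiable one_ne_zero).differentiableAt)
      ((hg.continuous_deriv le_rfl).intervalIntegrable _ _)
  have hgK : ∀ t, |g t| ≤ K := fun t => hK _ (mem_range_self _)
  -- by Darboux, the derivative has constant sign
  have habs : ∫ t in a..b, |deriv g t| ≤ 2 * K := by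
    have ha := abs_le.1 (hgK a)
    have hb := abs_le.1 (hgK b)
    rcases hasDerivWithinAt_forall_lt_or_forall_gt_of_forall_ne (convex_Icc a b) hder hne with h | h
    · rw [intervalIntegral.integral_congr (g := fun t => -deriv g t), intervalIntegral.integral_neg,
        hint]
      · linarith
      · intro t ht
        rw [uIcc_of_le hab] at ht
        exact abs_of_neg (h t ht)
    · rw [intervalIntegral.integral_congr (g := fun t => deriv g t), hint]
      · linarith
      · intro t ht
        rw [uIcc_of_le hab] at ht
        exact abs_of_pos (h t ht)
  calc ∫⁻ t in Icc a b, ‖mfderiv 𝓘(ℝ, ℝ) (𝓡 n) γ t 1‖ₑ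
      ≤ ∫⁻ t in Icc a b, ENNReal.ofReal (C * |deriv g t|) := by
        refine setLIntegral_mono' measurableSet_Icc fun t ht => ?_
        rw [← ofReal_norm]
        exact ENNReal.ofReal_le_ofReal (hsp t ht)
    _ = ENNReal.ofReal (∫ t in Icc a b, C * |deriv g t|) := by
        refine (ofReal_integral_eq_lintegral_ofReal ?_ (ae_of_all _ fun t => by positivity)).symm
        exact (continuous_const.mul (hg.continuous_deriv le_rfl).abs).integrableOn_Icc
    _ ≤ ENNReal.ofReal (C * (2 * K)) := by
        refine ENNReal.ofReal_le_ofReal ?_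
        rw [integral_Icc_eq_integral_Ioc, ← intervalIntegral.integral_of_le hab,
          intervalIntegral.integral_const_mul]
        exact mul_le_mul_of_nonneg_left habs hC.le

end Arc

/-! ### Leaves have uniformly bounded length -/

section Length

/-- The integral of a periodic function over one period of a set is at most its integral over any
set which contains an integer translate of each point. -/
theorem setLIntegral_Ioc_le_of_periodic {F : ℝ → ℝ≥0∞} (hF : Measurable F)
    (hper : Function.Periodic F 1) {J S : Set ℝ} (hJ : MeasurableSet J)
    (hS : ∀ t ∈ S, ∃ m : ℤ, t + m ∈ J) :
    ∫⁻ t in S ∩ Ioc 0 1, F t ≤ ∫⁻ t in J, F t := by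
  have hsub : S ∩ Ioc 0 1 ⊆ ⋃ m : ℤ, (fun t : ℝ => t + m) ⁻¹' (J ∩ Ioc (m : ℝ) (m + 1)) := by
    rintro t ⟨htS, ht0, ht1⟩
    obtain ⟨m, hm⟩ := hS t htS
    exact mem_iUnion.2 ⟨m, hm, by linarith, by linarith⟩
  have htr : ∀ m : ℤ, ∫⁻ t in (fun t : ℝ => t + m) ⁻¹' (J ∩ Ioc (m : ℝ) (m + 1)), F t
      = ∫⁻ t in J ∩ Ioc (m : ℝ) (m + 1), F t := fun m => by
    rw [← (measurePreserving_add_right volume (m : ℝ)).setLIntegral_comp_preimage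
      (hJ.inter measurableSet_Ioc) hF]
    refine lintegral_congr fun t => ?_
    simpa using (hper.int_mul m t).symm
  calc ∫⁻ t in S ∩ Ioc 0 1, F t
      ≤ ∫⁻ t in ⋃ m : ℤ, (fun t : ℝ => t + m) ⁻¹' (J ∩ Ioc (m : ℝ) (m + 1)), F t :=
        lintegral_mono_set hsub
    _ ≤ ∑' m : ℤ, ∫⁻ t in (fun t : ℝ => t + m) ⁻¹' (J ∩ Ioc (m : ℝ) (m + 1)), F t :=
        lintegral_iUnion_le _ _
    _ = ∑' m : ℤ, ∫⁻ t in J ∩ Ioc (m : ℝ) (m + 1), F t := tsum_congr htr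
    _ = ∫⁻ t in ⋃ m : ℤ, J ∩ Ioc (m : ℝ) (m + 1), F t :=
        (lintegral_iUnion (fun m => hJ.inter measurableSet_Ioc)
          ((pairwise_disjoint_Ioc_intCast ℝ).mono fun _ _ h =>
            h.mono inter_subset_right inter_subset_right) _).symm
    _ = ∫⁻ t in J, F t := by rw [← inter_iUnion, iUnion_Ioc_intCast, inter_univ]

/-- A path in a simple closed curve lifts to the universal cover of the curve. -/
theorem exists_continuous_lift_of_periodic {M : Type*} [TopologicalSpace M] [T2Space M]
    {γ : ℝ → M} (hc : Continuous γ) (hper : Function.Periodic γ 1) (hinj : InjOn γ (Ioc 0 1))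
    {h : ℝ → M} (hh : Continuous h) (hr : ∀ s, h s ∈ range γ) :
    ∃ σ : ℝ → ℝ, Continuous σ ∧ ∀ s, γ (σ s) = h s := by
  let γ' : AddCircle (1 : ℝ) → M := hper.lift
  have hγ' : ∀ t : ℝ, γ' (t : AddCircle (1 : ℝ)) = γ t := fun t => hper.lift_coe t
  have hc' : Continuous γ' := continuous_coinduced_dom.2 hc
  have hinj' : Function.Injective γ' := fun x y hxy => by
    have hsurj : ∀ z : AddCircle (1 : ℝ), ∃ t ∈ Ioc (0 : ℝ) 1, (t : AddCircle (1 : ℝ)) = z :=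
      fun z => by
        have : z ∈ ((↑) : ℝ → AddCircle (1 : ℝ)) '' Ioc 0 (0 + 1) := by
          rw [AddCircle.coe_image_Ioc_eq]; trivial
        simpa using this
    obtain ⟨s, hs, rfl⟩ := hsurj x
    obtain ⟨t, ht, rfl⟩ := hsurj y
    rw [hinj hs ht (by simpa [hγ'] using hxy)]
  have hemb : IsEmbedding γ' := (hc'.isClosedEmbedding hinj').isEmbedding
  have hr' : ∀ s, ∃ z, γ' z = h s := fun s => by
    obtain ⟨t, ht⟩ := hr s
    exact ⟨t, by rw [hγ', ht]⟩
  choose z hz using hr'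
  have hzc : Continuous z := hemb.continuous_iff.2 (by
    rw [show γ' ∘ z = h from funext hz]; exact hh)
  obtain ⟨t₀, ht₀⟩ := QuotientAddGroup.mk_surjective (z 0)
  obtain ⟨σ, ⟨-, hσ⟩, -⟩ := (AddCircle.isCoveringMap_coe (1 : ℝ)).existsUnique_continuousMap_lifts
    ⟨z, hzc⟩ 0 t₀ ht₀
  refine ⟨σ, σ.continuous, fun s => ?_⟩
  rw [← hγ', ← hz]
  exact congrArg γ' (congrFun hσ s)

theorem exists_int_of_periodic_injOn {M : Type*} {γ : ℝ → M} (hper : Function.Periodic γ 1)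
    (hinj : InjOn γ (Ioc 0 1)) {s t : ℝ} (h : γ s = γ t) : ∃ m : ℤ, s + m = t := by
  have h1 : ∀ r : ℝ, ∃ m : ℤ, r + m ∈ Ioc (0 : ℝ) 1 := fun r => by
    obtain ⟨m, hm, -⟩ := existsUnique_add_zsmul_mem_Ioc (zero_lt_one (α := ℝ)) r 0
    exact ⟨m, by simpa using hm⟩
  obtain ⟨a, ha⟩ := h1 s
  obtain ⟨b, hb⟩ := h1 t
  have e : ∀ (r : ℝ) (m : ℤ), γ (r + m) = γ r := fun r m => by simpa using hper.int_mul m r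
  have := hinj ha hb (by rw [e, e, h])
  exact ⟨a - b, by push_cast; linarith⟩

variable {n : ℕ} {M : Type*} [TopologicalSpace M]
    [ChartedSpace (EuclideanSpace ℝ (Fin n)) M]

theorem IsCenterCircleFibration.exists_ne_zero_span_eq {f : M → M}
    {Ec : ∀ x : M, Submodule ℝ (TangentSpace (𝓡 n) x)} 
    {B : Type*} [TopologicalSpace B] {p : M → B}
    (hp : IsCenterCircleFibration f Ec p) (x : M) :
    ∃ v : TangentSpace (𝓡 n) x, v ≠ 0 ∧ Submodule.span ℝ {v} = Ec x := by
  obtain ⟨γ, hγ⟩ := hp.leaf (p x)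
  have hx : x ∈ range γ := hγ.range_eq ▸ (rfl : x ∈ p ⁻¹' {p x})
  obtain ⟨t, rfl⟩ := hx
  exact ⟨_, hγ.velocity_ne_zero t, hγ.tangent t⟩

theorem periodic_speed [RiemannianBundle (fun x : M => TangentSpace (𝓡 n) x)]
    {γ : ℝ → M} (hγ : ContMDiff 𝓘(ℝ, ℝ) (𝓡 n) 1 γ)
    (hper : Function.Periodic γ 1) :
    Function.Periodic (fun t => ‖mfderiv 𝓘(ℝ, ℝ) (𝓡 n) γ t 1‖ₑ) 1 := fun t => by
  let τ : ℝ → ℝ := fun t => t + 1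
  have hcomp : γ ∘ τ = γ := funext hper
  have hcongr : ∀ g : ℝ → M, g = γ →
      ‖mfderiv 𝓘(ℝ, ℝ) (𝓡 n) g t 1‖ₑ = ‖mfderiv 𝓘(ℝ, ℝ) (𝓡 n) γ t 1‖ₑ := by
    rintro g rfl; rfl
  have hτ : HasDerivAt τ 1 t := (hasDerivAt_id t).add_const 1
  have hτ1 : mfderiv 𝓘(ℝ, ℝ) 𝓘(ℝ, ℝ) τ t (1 : ℝ) = (1 : ℝ) := by
    rw [mfderiv_eq_fderiv]
    exact fderiv_apply_one_eq_deriv.trans hτ.deriv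
  have hd := mfderiv_comp (I := 𝓘(ℝ, ℝ)) (I' := 𝓘(ℝ, ℝ)) (I'' := 𝓡 n) t
    (hγ.mdifferentiableAt one_ne_zero (x := τ t)) hτ.differentiableAt.mdifferentiableAt
  have hd1 : mfderiv 𝓘(ℝ, ℝ) (𝓡 n) (γ ∘ τ) t (1 : ℝ)
      = mfderiv 𝓘(ℝ, ℝ) (𝓡 n) γ (τ t) (1 : ℝ) := by
    have := congrArg (fun T => T (1 : ℝ)) hd
    refine this.trans ?_
    exact congrArg (mfderiv 𝓘(ℝ, ℝ) (𝓡 n) γ (τ t)) hτ1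
  exact (congrArg (fun w : TangentSpace (𝓡 n) (γ (τ t)) => ‖w‖ₑ) hd1.symm).trans (hcongr _ hcomp)

variable [T2Space M] [CompactSpace M] [IsManifold (𝓡 n) ∞ M]
    [RiemannianBundle (fun x : M => TangentSpace (𝓡 n) x)]
    [IsContinuousRiemannianBundle (EuclideanSpace ℝ (Fin n))
      (fun x : M => TangentSpace (𝓡 n) x)]
    {B : Type*} [TopologicalSpace B]

/-- The part of a leaf that lies in a small flow box of the fibration is an arc, so that its
length is bounded uniformly in the leaf. -/
theorem exists_nhds_length_le {f : M → M}
    {Ec : ∀ x : M, Submodule ℝ (TangentSpace (𝓡 n) x)} (hc : IsContinuousSubbundle Ec) {p : M → B}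
    (hp : IsCenterCircleFibration f Ec p) (x₀ : M) :
    ∃ S ∈ 𝓝 x₀, ∃ C : ℝ≥0∞, C < ⊤ ∧ ∀ (b : B) (γ : ℝ → M),
      IsLeafParametrization Ec (p ⁻¹' {b}) γ →
        ∫⁻ t in γ ⁻¹' S ∩ Ioc 0 1, ‖mfderiv 𝓘(ℝ, ℝ) (𝓡 n) γ t 1‖ₑ ≤ C := by
  obtain ⟨W, hWo, hxW, C, hC, hW⟩ := exists_arc_length_le hc hp.exists_ne_zero_span_eq x₀
  obtain ⟨e, he⟩ := hp.locally_trivial (p x₀)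
  have hxs : x₀ ∈ e.source := e.mem_source.2 he
  let z₀ : Circle := (e x₀).2
  let φ : B × ℝ → B × Circle := fun q => (q.1, z₀ * Circle.exp q.2)
  have hφ : Continuous φ := by fun_prop
  have hφ0 : φ (p x₀, 0) = e x₀ := by
    simp only [φ, Circle.exp_zero, mul_one, z₀]
    exact e.mk_proj_snd hxs
  let H : B × ℝ → M := fun q => e.toOpenPartialHomeomorph.symm (φ q)
  have hHc : ContinuousAt H (p x₀, 0) :=
    (e.toOpenPartialHomeomorph.continuousAt_symm (e.mem_target.2 he)).comp hφ.continuousAt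
  have hH0 : H (p x₀, 0) = x₀ := by
    simp only [H, hφ0]
    exact e.toOpenPartialHomeomorph.left_inv hxs
  have hev : ∀ᶠ q in 𝓝 (p x₀) ×ˢ 𝓝 (0 : ℝ), H q ∈ W := by
    rw [← nhds_prod_eq]
    exact hHc.eventually (hWo.mem_nhds (hH0.symm ▸ hxW))
  obtain ⟨P, hP, Q, hQ, hPQ⟩ := eventually_prod_iff.1 hev
  obtain ⟨ε, hε, hεQ⟩ := Metric.nhds_basis_closedBall.mem_iff.1 hQ
  have hball : Metric.closedBall (0 : ℝ) ε = Icc (-ε) ε := by simp [Real.closedBall_eq_Icc]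
  rw [hball] at hεQ
  let A : Set Circle := (fun s => z₀ * Circle.exp s) '' Icc (-ε) ε
  have hA : A ∈ 𝓝 z₀ := by
    have h1 : Circle.exp '' Icc (-ε) ε ∈ 𝓝 (1 : Circle) := by
      rw [← Circle.exp_zero, ← isLocalHomeomorph_circleExp.map_nhds_eq 0]
      exact image_mem_map (Icc_mem_nhds (by linarith) hε)
    have h2 : A = (Homeomorph.mulLeft z₀) '' (Circle.exp '' Icc (-ε) ε) := by
      rw [image_image]; rfl
    rw [h2]
    simpa only [Homeomorph.coe_mulLeft, mul_one] using
      (Homeomorph.mulLeft z₀).isOpenMap.image_mem_nhds h1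
  refine ⟨{x | x ∈ e.source ∧ P (p x) ∧ (e x).2 ∈ A}, ?_, C, hC, ?_⟩
  · have h1 : ∀ᶠ x in 𝓝 x₀, P (p x) := (e.continuousAt_proj hxs).eventually hP
    have h2 : ∀ᶠ x in 𝓝 x₀, (e x).2 ∈ A :=
      (continuous_snd.continuousAt.comp (e.continuousAt hxs)).eventually hA
    filter_upwards [e.open_source.mem_nhds hxs, h1, h2] with x a b c using ⟨a, b, c⟩
  intro b γ hγ
  have hγp : ∀ t, p (γ t) = b := fun t => by
    have : γ t ∈ p ⁻¹' {b} := hγ.range_eq ▸ mem_range_self t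
    exact this
  by_cases hb : b ∈ e.baseSet ∧ P b
  swap
  · have : γ ⁻¹' {x | x ∈ e.source ∧ P (p x) ∧ (e x).2 ∈ A} = ∅ := by
      refine eq_empty_of_forall_notMem fun t ht => hb ?_
      rw [← hγp t]
      exact ⟨e.mem_source.1 ht.1, ht.2.1⟩
    simp only [this, empty_inter, Measure.restrict_empty, lintegral_zero_measure, zero_le]
  -- the arc of the leaf inside the flow box, lifted to the parameter line
  have hHb : Continuous fun s => H (b, s) := continuous_iff_continuousAt.2 fun s =>
    (e.toOpenPartialHomeomorph.continuousAt_symm (e.mem_target.2 hb.1)).comp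
      (f := fun s => φ (b, s)) (hφ.comp (Continuous.prodMk_right b)).continuousAt
  obtain ⟨σ, hσ, hσH⟩ := exists_continuous_lift_of_periodic hγ.contMDiff.continuous hγ.periodic
    hγ.injOn hHb fun s => by
      rw [hγ.range_eq]
      exact e.proj_symm_apply' hb.1
  obtain ⟨a', b', hJ, hle⟩ : ∃ a' b', σ '' Icc (-ε) ε = Icc a' b' ∧ a' ≤ b' := by
    have h1 : IsConnected (σ '' Icc (-ε) ε) :=
      (isConnected_Icc (by linarith)).image _ hσ.continuousOn
    have h2 : IsCompact (σ '' Icc (-ε) ε) := isCompact_Icc.image hσ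
    have h3 := eq_Icc_of_connected_compact h1 h2
    refine ⟨_, _, h3, ?_⟩
    rw [← nonempty_Icc, ← h3]
    exact h1.nonempty
  refine le_trans ?_ (hW _ γ hγ a' b' hle fun t ht => ?_)
  · refine setLIntegral_Ioc_le_of_periodic
      (continuous_enorm_speed hγ.contMDiff).measurable
      (periodic_speed hγ.contMDiff hγ.periodic) measurableSet_Icc fun t ht => ?_
    obtain ⟨s, hs, hst⟩ := ht.2.2
    have h1 : γ (σ s) = γ t := by
      rw [hσH]
      change e.toOpenPartialHomeomorph.symm (b, z₀ * Circle.exp s) = γ t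
      have hst' : z₀ * Circle.exp s = (e (γ t)).2 := hst
      rw [hst', ← hγp t]
      exact e.symm_apply_mk_proj ht.1
    obtain ⟨m, hm⟩ := exists_int_of_periodic_injOn hγ.periodic hγ.injOn h1.symm
    exact ⟨m, by rw [hm, ← hJ]; exact mem_image_of_mem σ hs⟩
  · rw [← hJ] at ht
    obtain ⟨s, hs, rfl⟩ := ht
    rw [hσH]
    exact hPQ hb.2 (hεQ hs)

/-- The lengths of all leaves are bounded by one constant. -/
theorem exists_leaf_length_le {f : M → M}
    {Ec : ∀ x : M, Submodule ℝ (TangentSpace (𝓡 n) x)} (hc : IsContinuousSubbundle Ec) {p : M → B}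
    (hp : IsCenterCircleFibration f Ec p) :
    ∃ C : ℝ≥0∞, C < ⊤ ∧ ∀ (b : B) (γ : ℝ → M), IsLeafParametrization Ec (p ⁻¹' {b}) γ →
      ∫⁻ t in Ioc 0 1, ‖mfderiv 𝓘(ℝ, ℝ) (𝓡 n) γ t 1‖ₑ ≤ C := by
  have key : ∃ C : ℝ≥0∞, C < ⊤ ∧ ∀ (b : B) (γ : ℝ → M), IsLeafParametrization Ec (p ⁻¹' {b}) γ →
      ∫⁻ t in γ ⁻¹' univ ∩ Ioc 0 1, ‖mfderiv 𝓘(ℝ, ℝ) (𝓡 n) γ t 1‖ₑ ≤ C := by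
    refine isCompact_univ.induction_on (p := fun S : Set M => ∃ C : ℝ≥0∞, C < ⊤ ∧
      ∀ (b : B) (γ : ℝ → M), IsLeafParametrization Ec (p ⁻¹' {b}) γ →
        ∫⁻ t in γ ⁻¹' S ∩ Ioc 0 1, ‖mfderiv 𝓘(ℝ, ℝ) (𝓡 n) γ t 1‖ₑ ≤ C) ?_ ?_ ?_ ?_
    · exact ⟨0, by simp, fun b γ _ => by simp⟩
    · rintro S T hST ⟨C, hC, h⟩
      exact ⟨C, hC, fun b γ hγ => (lintegral_mono_set (by gcongr)).trans (h b γ hγ)⟩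
    · rintro S T ⟨C, hC, h⟩ ⟨D, hD, h'⟩
      refine ⟨C + D, ENNReal.add_lt_top.2 ⟨hC, hD⟩, fun b γ hγ => ?_⟩
      rw [preimage_union, union_inter_distrib_right]
      exact (lintegral_union_le _ _ _).trans (add_le_add (h b γ hγ) (h' b γ hγ))
    · intro x _
      obtain ⟨S, hS, h⟩ := exists_nhds_length_le hc hp x
      exact ⟨S, mem_nhdsWithin_of_mem_nhds hS, h⟩
  simpa using key

end Length

/-! ### Dynamics along the leaves -/

section Dynamics

variable {n : ℕ} {M : Type*} [TopologicalSpace M]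
    [ChartedSpace (EuclideanSpace ℝ (Fin n)) M]

theorem contMDiff_iterate (F : M ≃ₘ^1⟮𝓡 n, 𝓡 n⟯ M) (k : ℕ) :
    ContMDiff (𝓡 n) (𝓡 n) 1 F^[k] := by
  induction k with
  | zero => exact contMDiff_id
  | succ k ih => rw [Function.iterate_succ']; exact F.contMDiff.comp ih

theorem mfderiv_iterate_mem {F : M ≃ₘ^1⟮𝓡 n, 𝓡 n⟯ M}
    {V : ∀ x : M, Submodule ℝ (TangentSpace (𝓡 n) x)}
    (hV : ∀ x, (V x).map (mfderiv (𝓡 n) (𝓡 n) F x).toLinearMap = V (F x)) (k : ℕ) {x : M}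
    {v : TangentSpace (𝓡 n) x} (hv : v ∈ V x) :
    (mfderiv (𝓡 n) (𝓡 n) F^[k] x v : TangentSpace (𝓡 n) (F^[k] x)) ∈ V (F^[k] x) := by
  induction k with
  | zero =>
    have h0 : mfderiv (𝓡 n) (𝓡 n) (id : M → M) x v = v := by rw [mfderiv_id]; rfl
    exact (congrArg (fun w : TangentSpace (𝓡 n) x => w ∈ V x) h0).mpr hv
  | succ k ih =>
    have h1 : ∀ g : M → M, g = F ∘ F^[k] →
        (mfderiv (𝓡 n) (𝓡 n) g x v : TangentSpace (𝓡 n) (g x)) ∈ V (g x) := by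
      rintro g rfl
      rw [mfderiv_comp x (F.contMDiff.mdifferentiableAt one_ne_zero)
        ((contMDiff_iterate F k).mdifferentiableAt one_ne_zero)]
      have h2 : V ((F ∘ F^[k]) x) = _ := (hV (F^[k] x)).symm
      rw [h2]
      exact Submodule.mem_map_of_mem ih
    exact h1 _ (Function.iterate_succ' _ _)

theorem mfderiv_symm_apply_mfderiv (F : M ≃ₘ^1⟮𝓡 n, 𝓡 n⟯ M) (x : M)
    (v : TangentSpace (𝓡 n) x) :
    mfderiv (𝓡 n) (𝓡 n) F.symm (F x) (mfderiv (𝓡 n) (𝓡 n) F x v) = v := by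
  have h := mfderiv_comp x (F.symm.contMDiff.mdifferentiableAt one_ne_zero (x := F x))
    (F.contMDiff.mdifferentiableAt one_ne_zero (x := x))
  have h0 : F.symm ∘ F = id := funext F.symm_apply_apply
  rw [h0, mfderiv_id] at h
  exact (congrArg (fun T => T v) h).symm

theorem map_mfderiv_symm {F : M ≃ₘ^1⟮𝓡 n, 𝓡 n⟯ M}
    {V : ∀ x : M, Submodule ℝ (TangentSpace (𝓡 n) x)}
    (hV : ∀ x, (V x).map (mfderiv (𝓡 n) (𝓡 n) F x).toLinearMap = V (F x)) (x : M) :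
    (V x).map (mfderiv (𝓡 n) (𝓡 n) F.symm x).toLinearMap = V (F.symm x) := by
  obtain ⟨y, rfl⟩ : ∃ y, F y = x := ⟨F.symm x, F.apply_symm_apply x⟩
  rw [← hV y]
  have h1 : ∀ z, z = y → ∀ S : Submodule ℝ (TangentSpace (𝓡 n) z),
    (∀ v : EuclideanSpace ℝ (Fin n), v ∈ S ↔ v ∈ V y) → S = V z := by
    rintro z rfl S hS
    exact Submodule.ext hS
  refine h1 _ (F.symm_apply_apply y) _ fun v => ?_
  constructor
  · rintro ⟨_, ⟨w, hw, rfl⟩, rfl⟩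
    have := mfderiv_symm_apply_mfderiv F y w
    exact (congrArg (· ∈ V y) this).mpr hw
  · intro hv
    exact ⟨_, ⟨v, hv, rfl⟩, mfderiv_symm_apply_mfderiv F y v⟩

/-- The derivative of `f^k` undoes that of `f^{-k}`. This is stated for norms because the base point
`f^k (f^{-k} x)` is only propositionally equal to `x`. -/
theorem norm_mfderiv_iterate_symm [RiemannianBundle (fun x : M => TangentSpace (𝓡 n) x)]
    (F : M ≃ₘ^1⟮𝓡 n, 𝓡 n⟯ M) (k : ℕ) (x : M) (w : TangentSpace (𝓡 n) x) :
    ‖(mfderiv (𝓡 n) (𝓡 n) F^[k] (F.symm^[k] x) (mfderiv (𝓡 n) (𝓡 n) F.symm^[k] x w) :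
      TangentSpace (𝓡 n) (F^[k] (F.symm^[k] x)))‖ = ‖w‖ := by
  have h := mfderiv_comp x
    ((contMDiff_iterate F k).mdifferentiableAt one_ne_zero (x := F.symm^[k] x))
    ((contMDiff_iterate F.symm k).mdifferentiableAt one_ne_zero (x := x))
  have h0 : F^[k] ∘ F.symm^[k] = id :=
    funext (Function.LeftInverse.iterate F.apply_symm_apply k)
  have h1 : ∀ g : M → M, g = id →
      ‖(mfderiv (𝓡 n) (𝓡 n) g x w : TangentSpace (𝓡 n) (g x))‖ = ‖w‖ := by
    rintro g rfl
    rw [mfderiv_id]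
    rfl
  rw [← h1 _ h0, h]
  rfl

/-- A diffeomorphism that preserves the line field maps leaves to leaves. -/
theorem IsLeafParametrization.comp_diffeomorph {F : M ≃ₘ^1⟮𝓡 n, 𝓡 n⟯ M}
    {V : ∀ x : M, Submodule ℝ (TangentSpace (𝓡 n) x)}
    (hV : ∀ x, (V x).map (mfderiv (𝓡 n) (𝓡 n) F x).toLinearMap = V (F x)) {L : Set M} {γ : ℝ → M}
    (hγ : IsLeafParametrization V L γ) : IsLeafParametrization V (F '' L) (F ∘ γ) := by
  have hd : ∀ t : ℝ, mfderiv 𝓘(ℝ, ℝ) (𝓡 n) (F ∘ γ) t (1 : ℝ)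
      = mfderiv (𝓡 n) (𝓡 n) F (γ t) (mfderiv 𝓘(ℝ, ℝ) (𝓡 n) γ t (1 : ℝ)) := fun t => by
    have h := mfderiv_comp t (F.contMDiff.mdifferentiableAt one_ne_zero (x := γ t))
      (hγ.contMDiff.mdifferentiableAt one_ne_zero (x := t))
    exact congrArg (fun T => T (1 : ℝ)) h
  refine ⟨F.contMDiff.comp hγ.contMDiff, hγ.periodic.comp F, F.injective.comp_injOn hγ.injOn, ?_,
    fun t => ?_, fun t => ?_⟩
  · rw [range_comp, hγ.range_eq]
  · intro h0
    refine hγ.velocity_ne_zero t ?_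
    have h1 := mfderiv_symm_apply_mfderiv F (γ t) (mfderiv 𝓘(ℝ, ℝ) (𝓡 n) γ t (1 : ℝ))
    exact h1.symm.trans ((congrArg (mfderiv (𝓡 n) (𝓡 n) F.symm (F (γ t)))
      ((hd t).symm.trans h0)).trans (map_zero _))
  · have h1 : V ((F ∘ γ) t) = _ := (hV (γ t)).symm
    rw [h1, ← hγ.tangent t, Submodule.map_span, image_singleton]
    congr 2
    exact hd t

theorem exists_image_fiber_eq {X B : Type*} (F : X ≃ X) {p : X → B} (hs : Function.Surjective p)
    (hF : ∀ x y, p x = p y ↔ p (F x) = p (F y)) (b : B) :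
    ∃ b', F '' (p ⁻¹' {b}) = p ⁻¹' {b'} := by
  obtain ⟨x, rfl⟩ := hs b
  refine ⟨p (F x), ?_⟩
  ext y
  constructor
  · rintro ⟨z, hz, rfl⟩
    exact (hF z x).1 hz
  · intro hy
    refine ⟨F.symm y, (hF _ _).2 ?_, F.apply_symm_apply y⟩
    rw [F.apply_symm_apply]
    exact hy

/-- Iterates of a fiber preserving diffeomorphism carry leaf parametrizations to leaf
parametrizations, so bounds on leaf lengths apply to the images of a leaf. -/
theorem IsLeafParametrization.exists_iterate {F : M ≃ₘ^1⟮𝓡 n, 𝓡 n⟯ M}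
    {V : ∀ x : M, Submodule ℝ (TangentSpace (𝓡 n) x)}
    (hV : ∀ x, (V x).map (mfderiv (𝓡 n) (𝓡 n) F x).toLinearMap = V (F x))
    {B : Type*} {p : M → B} (hs : Function.Surjective p)
    (hF : ∀ x y, p x = p y ↔ p (F x) = p (F y)) {b : B} {γ : ℝ → M}
    (hγ : IsLeafParametrization V (p ⁻¹' {b}) γ) (k : ℕ) :
    ∃ b', IsLeafParametrization V (p ⁻¹' {b'}) (F^[k] ∘ γ) := by
  induction k with
  | zero => exact ⟨b, hγ⟩
  | succ k ih =>
    obtain ⟨b', hb'⟩ := ih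
    obtain ⟨b'', hb''⟩ := exists_image_fiber_eq F.toEquiv hs hF b'
    refine ⟨b'', ?_⟩
    rw [Function.iterate_succ', ← hb'']
    exact hb'.comp_diffeomorph hV

variable [IsManifold (𝓡 n) ∞ M] [RiemannianBundle (fun x : M => TangentSpace (𝓡 n) x)]
    [IsContinuousRiemannianBundle (EuclideanSpace ℝ (Fin n))
      (fun x : M => TangentSpace (𝓡 n) x)]

/-- The leaf lengths being bounded, no set of positive arc length in a leaf can be stretched
indefinitely by iterates: this is Fatou's lemma applied to the speeds of the image leaves. -/
theorem leafLebesgue_eq_zero_of_tendsto_atTop [MeasurableSpace M] [BorelSpace M]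
    {F : M ≃ₘ^1⟮𝓡 n, 𝓡 n⟯ M} {V : ∀ x : M, Submodule ℝ (TangentSpace (𝓡 n) x)}
    (hV : ∀ x, (V x).map (mfderiv (𝓡 n) (𝓡 n) F x).toLinearMap = V (F x))
    {B : Type*} {p : M → B} (hs : Function.Surjective p)
    (hF : ∀ x y, p x = p y ↔ p (F x) = p (F y)) {C : ℝ≥0∞} (hC : C < ⊤)
    (hlen : ∀ (b : B) (γ : ℝ → M), IsLeafParametrization V (p ⁻¹' {b}) γ →
      ∫⁻ t in Ioc 0 1, ‖mfderiv 𝓘(ℝ, ℝ) (𝓡 n) γ t 1‖ₑ ≤ C)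
    {A : Set M} (hA : MeasurableSet A) {φ : ℕ → ℕ}
    (hexp : ∀ x ∈ A, ∀ v ∈ V x, v ≠ 0 →
      Tendsto (fun j => ‖mfderiv (𝓡 n) (𝓡 n) F^[φ j] x v‖) atTop atTop)
    {b : B} {γ : ℝ → M} (hγ : IsLeafParametrization V (p ⁻¹' {b}) γ) :
    leafLebesgue n γ A = 0 := by
  let S : ℕ → ℝ → ℝ≥0∞ := fun j t => ‖mfderiv 𝓘(ℝ, ℝ) (𝓡 n) (F^[φ j] ∘ γ) t 1‖ₑ
  have hS : ∀ j, Measurable (S j) := fun j =>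
    (continuous_enorm_speed ((contMDiff_iterate F (φ j)).comp hγ.contMDiff)).measurable
  have hSC : ∀ j, ∫⁻ t in Ioc 0 1, S j t ≤ C := fun j => by
    obtain ⟨b', hb'⟩ := hγ.exists_iterate hV hs hF (φ j)
    exact hlen b' _ hb'
  have hfatou : ∫⁻ t in Ioc 0 1, liminf (fun j => S j t) atTop ≤ C :=
    (lintegral_liminf_le hS).trans (liminf_le_of_le (by isBoundedDefault) fun c hc => by
      obtain ⟨j, hj⟩ := hc.exists
      exact hj.trans (hSC j))
  have hlt := ae_lt_top (Measurable.liminf hS) (hfatou.trans_lt hC).ne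
  have hnull : (volume.restrict (Ioc (0 : ℝ) 1)) (γ ⁻¹' A) = 0 := by
    refine measure_mono_null (fun t ht => ?_) hlt
    have h1 := hexp (γ t) ht (mfderiv 𝓘(ℝ, ℝ) (𝓡 n) γ t 1)
      (by rw [← hγ.tangent t]; exact Submodule.mem_span_singleton_self _) (hγ.velocity_ne_zero t)
    have h2 : Tendsto (fun j => S j t) atTop (𝓝 ⊤) := by
      refine (ENNReal.tendsto_ofReal_atTop.comp h1).congr fun j => ?_
      have h3 := mfderiv_comp t
        ((contMDiff_iterate F (φ j)).mdifferentiableAt one_ne_zero (x := γ t))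
        (hγ.contMDiff.mdifferentiableAt one_ne_zero (x := t))
      simp only [S, Function.comp_apply]
      rw [h3, ← ofReal_norm]
      rfl
    simp [h2.liminf_eq]
  rw [leafLebesgue, Measure.map_apply hγ.contMDiff.continuous.measurable hA]
  exact withDensity_absolutelyContinuous _ _ hnull

/-- The set where the derivative of a `C^1` map stretches a continuous line field by at most a
given factor is closed. -/
theorem isClosed_norm_mfderiv_le {V : ∀ x : M, Submodule ℝ (TangentSpace (𝓡 n) x)}
    (hV : IsContinuousSubbundle V)
    (h1 : ∀ x, ∃ v : TangentSpace (𝓡 n) x, v ≠ 0 ∧ Submodule.span ℝ {v} = V x)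
    {F : M → M} (hF : ContMDiff (𝓡 n) (𝓡 n) 1 F) (c : ℝ) :
    IsClosed {x | ∀ v ∈ V x, ‖mfderiv (𝓡 n) (𝓡 n) F x v‖ ≤ c * ‖v‖} := by
  rw [← isOpen_compl_iff, isOpen_iff_mem_nhds]
  intro x₀ hx₀
  obtain ⟨U, hU, hxU, Y, hY, hYs⟩ := hV.exists_frame_of_line h1 x₀
  have c1 := ((continuousOn_norm_tangent hY).const_mul c).continuousAt (hU.mem_nhds hxU)
  have c2 := (continuousOn_norm_tangent (b := F) (v := fun x => mfderiv (𝓡 n) (𝓡 n) F x (Y x))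
    ((hF.continuous_tangentMap le_rfl).comp_continuousOn hY)).continuousAt (hU.mem_nhds hxU)
  have hlt : c * ‖Y x₀‖ < ‖mfderiv (𝓡 n) (𝓡 n) F x₀ (Y x₀)‖ := by
    by_contra! hle
    refine hx₀ fun v hv => ?_
    rw [← (hYs x₀ hxU).2] at hv
    obtain ⟨a, rfl⟩ := Submodule.mem_span_singleton.1 hv
    rw [map_smul, norm_smul, norm_smul]
    nlinarith [norm_nonneg a, hle]
  filter_upwards [c1.eventually_lt c2 hlt, hU.mem_nhds hxU] with x hx hxU' hmem
  refine (hmem (Y x) ?_).not_gt hx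
  rw [← (hYs x hxU').2]
  exact Submodule.mem_span_singleton_self _

end Dynamics

/-! ### Orbits with nonzero exponent -/

section Exponent

variable {n : ℕ} {M : Type*} [TopologicalSpace M]
    [ChartedSpace (EuclideanSpace ℝ (Fin n)) M]
    [RiemannianBundle (fun x : M => TangentSpace (𝓡 n) x)]
    [MeasurableSpace M]

theorem tendsto_nat_mul_of_tendsto_div {L : ℕ → ℝ} {l c : ℝ}
    (h : Tendsto (fun k : ℕ => 1 / (k : ℝ) * L k) atTop (𝓝 l)) (hc : c < l) :
    Tendsto (fun k : ℕ => L k - c * k) atTop atTop := by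
  have h1 := (tendsto_natCast_atTop_atTop (R := ℝ)).atTop_mul_pos (sub_pos.2 hc) (h.sub_const c)
  refine h1.congr' ?_
  filter_upwards [eventually_gt_atTop 0] with k hk
  have : (k : ℝ) ≠ 0 := by positivity
  field_simp

/-- If the center exponent is positive, center vectors grow almost surely. -/
theorem HasCenterExponent.ae_tendsto_of_pos {f : M → M}
    {Ec : ∀ x : M, Submodule ℝ (TangentSpace (𝓡 n) x)} {μ : Measure M} {lam : ℝ}
    (h : HasCenterExponent f Ec μ lam) (hlam : 0 < lam) :
    ∀ᵐ x ∂μ, ∀ v ∈ Ec x, v ≠ 0 →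
      Tendsto (fun k : ℕ => ‖mfderiv (𝓡 n) (𝓡 n) f^[k] x v‖) atTop atTop := by
  filter_upwards [h] with x hx v hv hv0
  have h1 := tendsto_nat_mul_of_tendsto_div (hx v hv hv0) hlam
  refine tendsto_atTop_mono (fun k => ?_) h1
  simpa using Real.log_le_self (norm_nonneg (mfderiv (𝓡 n) (𝓡 n) f^[k] x v))

/-- A negative center exponent gives eventual exponential contraction of the whole center line, at
half the rate. -/
theorem HasCenterExponent.ae_eventually_le_of_neg {f : M → M}
    {Ec : ∀ x : M, Submodule ℝ (TangentSpace (𝓡 n) x)} {μ : Measure M} {lam : ℝ}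
    (h : HasCenterExponent f Ec μ lam) (hlam : lam < 0)
    (h1 : ∀ x, ∃ v : TangentSpace (𝓡 n) x, v ≠ 0 ∧ Submodule.span ℝ {v} = Ec x) :
    ∀ᵐ x ∂μ, ∀ᶠ k : ℕ in atTop, ∀ v ∈ Ec x,
      ‖mfderiv (𝓡 n) (𝓡 n) f^[k] x v‖ ≤ Real.exp (lam / 2 * k) * ‖v‖ := by
  filter_upwards [h] with x hx
  obtain ⟨v, hv0, hv⟩ := h1 x
  have h2 := hx v (hv ▸ Submodule.mem_span_singleton_self v) hv0
  have h3 := tendsto_nat_mul_of_tendsto_div (c := -lam / 2)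
    (L := fun k => -Real.log ‖mfderiv (𝓡 n) (𝓡 n) f^[k] x v‖) (l := -lam)
    (by simpa using h2.neg) (by linarith)
  filter_upwards [h3.eventually_ge_atTop (-Real.log ‖v‖)] with k hk w hw
  rw [← hv] at hw
  obtain ⟨a, rfl⟩ := Submodule.mem_span_singleton.1 hw
  have h4 : ‖mfderiv (𝓡 n) (𝓡 n) f^[k] x v‖ ≤ Real.exp (lam / 2 * k) * ‖v‖ := by
    -- valid also where the norm vanishes and `Real.log` takes the value `0`
    refine (Real.le_exp_log _).trans ?_
    have h5 : Real.exp (Real.log ‖v‖) = ‖v‖ := Real.exp_log (norm_pos_iff.2 hv0)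
    rw [← h5, ← Real.exp_add]
    exact Real.exp_le_exp.2 (by linarith)
  rw [map_smul, norm_smul, norm_smul]
  nlinarith [norm_nonneg a, h4]

/-- If the center exponent is negative, center vectors grow almost surely along a subsequence of
the backward iterates. By invariance of the measure, the exponential contraction at time `k`
holds at `f^{-k} x` up to a set of small measure; the Borel-Cantelli lemma along a subsequence then
gives an almost sure statement without recourse to the ergodic theorem. -/
theorem HasCenterExponent.exists_ae_tendsto_symm_of_neg [IsManifold (𝓡 n) ∞ M]
    [IsContinuousRiemannianBundle (EuclideanSpace ℝ (Fin n))
      (fun x : M => TangentSpace (𝓡 n) x)] [BorelSpace M] {f : M ≃ₘ^1⟮𝓡 n, 𝓡 n⟯ M}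
    {Ec : ∀ x : M, Submodule ℝ (TangentSpace (𝓡 n) x)} {μ : Measure M} [IsFiniteMeasure μ]
    {lam : ℝ} (h : HasCenterExponent f Ec μ lam) (hlam : lam < 0) (hμ : MeasurePreserving f μ μ)
    (hc : IsContinuousSubbundle Ec)
    (h1 : ∀ x, ∃ v : TangentSpace (𝓡 n) x, v ≠ 0 ∧ Submodule.span ℝ {v} = Ec x)
    (hEc : ∀ x, (Ec x).map (mfderiv (𝓡 n) (𝓡 n) f x).toLinearMap = Ec (f x)) :
    ∃ φ : ℕ → ℕ, ∀ᵐ x ∂μ, ∀ v ∈ Ec x, v ≠ 0 →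
      Tendsto (fun j : ℕ => ‖mfderiv (𝓡 n) (𝓡 n) f.symm^[φ j] x v‖) atTop atTop := by
  let E : ℕ → Set M := fun k =>
    {x | ∀ v ∈ Ec x, ‖mfderiv (𝓡 n) (𝓡 n) f^[k] x v‖ ≤ Real.exp (lam / 2 * k) * ‖v‖}
  have hE : ∀ k, MeasurableSet (E k)ᶜ := fun k =>
    (isClosed_norm_mfderiv_le hc h1 (contMDiff_iterate f k) _).measurableSet.compl
  have hlim : Tendsto (fun k => μ (E k)ᶜ) atTop (𝓝 0) := by
    have := tendsto_measure_of_ae_tendsto_indicator_of_isFiniteMeasure (μ := μ) (L := atTop)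
      (A := ∅) MeasurableSet.empty hE (by
        filter_upwards [h.ae_eventually_le_of_neg hlam h1] with x hx
        filter_upwards [hx] with k hk
        exact ⟨fun hn => hn hk, fun hn => hn.elim⟩)
    simpa using this
  obtain ⟨φ, hφ, hφE⟩ := extraction_forall_of_eventually
    (P := fun j k => μ (E k)ᶜ ≤ (2⁻¹ : ℝ≥0∞) ^ j) fun j =>
      hlim.eventually_le_const (ENNReal.pow_pos (ENNReal.inv_pos.2 ENNReal.ofNat_ne_top) j)
  refine ⟨φ, ?_⟩
  have hpre : ∀ k, μ (f.symm^[k] ⁻¹' (E k)ᶜ) = μ (E k)ᶜ := fun k => by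
    rw [← (hμ.iterate k).measure_preimage
      ((contMDiff_iterate f.symm k).continuous.measurable (hE k)).nullMeasurableSet]
    congr 1
    ext x
    simp only [mem_preimage]
    rw [Function.LeftInverse.iterate f.symm_apply_apply k x]
  have hsum : ∑' j, μ (f.symm^[φ j] ⁻¹' (E (φ j))ᶜ) ≠ ⊤ := by
    refine ne_top_of_le_ne_top (b := ∑' j : ℕ, (2⁻¹ : ℝ≥0∞) ^ j) ?_
      (ENNReal.tsum_le_tsum fun j => (hpre _).trans_le (hφE j))
    rw [ENNReal.tsum_geometric]
    simp
  filter_upwards [ae_eventually_notMem hsum] with x hx w hw hw0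
  have hgrow : Tendsto (fun j : ℕ => Real.exp (-lam / 2 * φ j) * ‖w‖) atTop atTop := by
    refine Tendsto.atTop_mul_const (norm_pos_iff.2 hw0) (Real.tendsto_exp_atTop.comp ?_)
    exact (tendsto_natCast_atTop_atTop.comp hφ.tendsto_atTop).const_mul_atTop (by linarith)
  refine tendsto_atTop_mono' _ ?_ hgrow
  filter_upwards [hx] with j hj
  have hj' : f.symm^[φ j] x ∈ E (φ j) := not_not.1 hj
  have h2 := hj' _ (mfderiv_iterate_mem (map_mfderiv_symm hEc) (φ j) hw)
  rw [norm_mfderiv_iterate_symm] at h2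
  calc Real.exp (-lam / 2 * φ j) * ‖w‖
      ≤ Real.exp (-lam / 2 * φ j) * (Real.exp (lam / 2 * φ j) * _) :=
        mul_le_mul_of_nonneg_left h2 (Real.exp_pos _).le
    _ = _ := by
        rw [← mul_assoc, ← Real.exp_add]
        ring_nf
        simp

end Exponent

end CenterFoliation

/-! ### Mutual singularity of conditional measures and arc length -/

theorem theorem5p2 {n : ℕ} {M : Type*} [TopologicalSpace M] [T2Space M] [CompactSpace M]
    [ChartedSpace (EuclideanSpace ℝ (Fin n)) M] [IsManifold (𝓡 n) ∞ M]
    [RiemannianBundle (fun x : M => TangentSpace (𝓡 n) x)]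
    [IsContinuousRiemannianBundle (EuclideanSpace ℝ (Fin n))
      (fun x : M => TangentSpace (𝓡 n) x)]
    [MeasurableSpace M] [BorelSpace M]
    {B : Type*} [TopologicalSpace B] [MeasurableSpace B] [BorelSpace B]
    (f : M ≃ₘ^1⟮𝓡 n, 𝓡 n⟯ M)
    (Es Ec Eu : ∀ x : M, Submodule ℝ (TangentSpace (𝓡 n) x))
    (hf : CenterFoliation.IsPartiallyHyperbolic f Es Ec Eu)
    (p : M → B) (hp : CenterFoliation.IsCenterCircleFibration f Ec p)
    (μ : Measure M) [IsProbabilityMeasure μ] (hμ : Ergodic f μ)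
    (lam : ℝ) (hlam : CenterFoliation.HasCenterExponent f Ec μ lam) (hlam_ne : lam ≠ 0) :
    (∃ κ : B → Measure M, CenterFoliation.IsConditionalSystem p μ κ) ∧
    ∀ κ : B → Measure M, CenterFoliation.IsConditionalSystem p μ κ →
      ∀ᵐ b ∂(μ.map p), ∀ γ : ℝ → M,
        CenterFoliation.IsLeafParametrization Ec (p ⁻¹' {b}) γ →
          Measure.MutuallySingular (κ b) (CenterFoliation.leafLebesgue n γ) := by
  have hs : Function.Surjective p := fun b => by
    obtain ⟨γ, hγ⟩ := hp.leaf b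
    have : γ 0 ∈ p ⁻¹' {b} := hγ.range_eq ▸ mem_range_self 0
    exact ⟨γ 0, this⟩
  have hq := CenterFoliation.isOpenQuotientMap_of_locally_trivial hp.locally_trivial hs
  have hT2 : T2Space B := CenterFoliation.t2Space_base hp.locally_trivial hs
  have hM2 : SecondCountableTopology M :=
    ChartedSpace.secondCountable_of_sigmaCompact (EuclideanSpace ℝ (Fin n)) M
  let _ := TopologicalSpace.metrizableSpaceMetric M
  have hMP : PolishSpace M := inferInstance
  have hB2 : SecondCountableTopology B := hq.isQuotientMap.secondCountableTopology hq.isOpenMap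
  refine ⟨CenterFoliation.exists_isConditionalSystem hq.continuous.measurable μ, fun κ hκ => ?_⟩
  obtain ⟨C, hC, hlen⟩ := CenterFoliation.exists_leaf_length_le hf.continuous_c hp
  -- it suffices to find a diffeomorphism preserving the leaves, some iterates of which stretch
  -- almost every center vector indefinitely
  have key : ∀ (F : M ≃ₘ^1⟮𝓡 n, 𝓡 n⟯ M) (φ : ℕ → ℕ),
      (∀ x, (Ec x).map (mfderiv (𝓡 n) (𝓡 n) F x).toLinearMap = Ec (F x)) →
      (∀ x y, p x = p y ↔ p (F x) = p (F y)) →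
      (∀ᵐ x ∂μ, ∀ v ∈ Ec x, v ≠ 0 →
        Tendsto (fun j => ‖mfderiv (𝓡 n) (𝓡 n) F^[φ j] x v‖) atTop atTop) →
      ∀ᵐ b ∂(μ.map p), ∀ γ : ℝ → M,
        CenterFoliation.IsLeafParametrization Ec (p ⁻¹' {b}) γ →
          Measure.MutuallySingular (κ b) (CenterFoliation.leafLebesgue n γ) := by
    intro F φ hEc hF hgrow
    obtain ⟨N, hN, hNm, hN0⟩ := exists_measurable_superset_of_null (ae_iff.1 hgrow)
    filter_upwards [hκ.ae_eq_zero hNm hN0] with b hb γ hγ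
    refine ⟨N, hNm, hb, ?_⟩
    refine CenterFoliation.leafLebesgue_eq_zero_of_tendsto_atTop hEc hs hF hC hlen hNm.compl
      (φ := φ) (fun x hx => ?_) hγ
    by_contra hcon
    exact hx (hN hcon)
  rcases lt_or_gt_of_ne hlam_ne with hneg | hpos
  · obtain ⟨φ, hφ⟩ := hlam.exists_ae_tendsto_symm_of_neg hneg hμ.toMeasurePreserving
      hf.continuous_c hp.exists_ne_zero_span_eq hf.map_c
    refine key f.symm φ (CenterFoliation.map_mfderiv_symm hf.map_c) (fun x y => ?_) hφ
    have := hp.invariant (f.symm x) (f.symm y)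
    rw [f.apply_symm_apply, f.apply_symm_apply] at this
    exact this.symm
  · exact key f id hf.map_c hp.invariant (hlam.ae_tendsto_of_pos hpos)
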